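/- For $n\in\mathbb N$, a language $L\subseteq\{0,1\}^*$ and a probability distribution $D_n$ on $\{0,1\}^n$, let $$|\psi_n^{L,D}\rangle=\sum_{x\in\{0,1\}^n}\sqrt{D_n(x)}\,|x\rangle\otimes|\mathbb 1\{x\in L\}\rangle .$$ For a sequence $D=\{D_n\}_{n\in\mathbb N}$ of such distributions, let $\mathbf{BQP/qsamp}(D)$ be the class of languages $L$ for which there exist a polynomial $p$ and a quantum algorithm running in polynomial time (a family of quantum circuits over the gates Hadamard, $T$, NOT, CNOT and Toffoli, one circuit for each input length $n$, whose descriptions are produced from $1^n$ by a deterministic Turing machine in time polynomial in $n$) that, for every $n$ and every $x\in\{0,1\}^n$, given $|x\rangle$, the advice state $|\psi_n^{L,D}\rangle^{\otimes p(n)}$ and ancilla qubits in state $|0\rangle$, outputs $\mathbb 1\{x\in L\}$ with probability at least $2/3$. Let $\mathbf{BQP/qsamp}$ be the class of languages $L$ that belong to $\mathbf{BQP/qsamp}(D)$ for some sequence of distributions $D$ (which may depend on $L$). Theorem. For every sequence of distributions $D=\{D_n\}_{n\in\mathbb N}$, with $D_n$ a probability distribution on $\{0,1\}^n$, $\mathbf{BQP/qsamp}(D)$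 is a proper subset of $\mathbf{BQP/qsamp}$. -/

import Mathlib

/-! ### Quantum circuits over the gate set Hadamard, T, NOT, controlled-NOT, Toffoli -/

/-- A gate acting on qubits indexed by `ι`. -/
inductive Gate (ι : Type) : Type
  | hadamard (i : ι)
  | phaseT (i : ι)
  | not (i : ι)
  | cnot (c t : ι) (h : c ≠ t)
  | toffoli (c₁ c₂ t : ι) (h : c₁ ≠ c₂) (h₁ : c₁ ≠ t) (h₂ : c₂ ≠ t)

/-- The amplitudes, in the computational basis, of a vector in the state space of the qubits
indexed by `ι`. -/
abbrev QState (ι : Type) : Type := (ι → Bool) → ℂ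

/-- The unitary action of a gate on state vectors. -/
noncomputable def Gate.apply {ι : Type} [DecidableEq ι] : Gate ι → QState ι → QState ι
  | .hadamard i, ψ => fun c =>
      ((Real.sqrt 2 : ℝ) : ℂ)⁻¹ *
        (ψ (Function.update c i false) +
          (if c i = true then -1 else 1) * ψ (Function.update c i true))
  | .phaseT i, ψ => fun c =>
      (if c i = true then Complex.exp (Complex.I * (Real.pi / 4)) else 1) * ψ c
  | .not i, ψ => fun c => ψ (Function.update c i (!(c i)))
  | .cnot a t _, ψ => fun c => ψ (Function.update c t (xor (c t) (c a)))
  | .toffoli a b t _ _ _, ψ => fun c => ψ (Function.update c t (xor (c t) (c a && c b)))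

/-- Apply the gates of a circuit, the head of the list first. -/
noncomputable def runGates {ι : Type} [DecidableEq ι] (gs : List (Gate ι)) (ψ : QState ι) :
    QState ι :=
  gs.foldl (fun φ g => g.apply φ) ψ

/-- The probability that measuring qubit `o` of the state `ψ` in the computational basis
gives the bit `b`. -/
noncomputable def measureProb {ι : Type} [Fintype ι] [DecidableEq ι] (ψ : QState ι) (o : ι)
    (b : Bool) : ℝ :=
  ∑ c : ι → Bool, if c o = b then ‖ψ c‖ ^ 2 else 0

/-! ### Qubits of a circuit with an input and quantum sampling advice -/

/-- The qubits of a circuit for inputs of length `n` which is given `p` copies of an `(n+1)`-qubit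
example state and `a` ancilla qubits: the input register, for each copy the `n` qubits of the
example and the qubit of its label, and the ancillas. -/
inductive Wire (n p a : ℕ) : Type
  | input (i : Fin n)
  | data (k : Fin p) (i : Fin n)
  | label (k : Fin p)
  | ancilla (i : Fin a)
  deriving DecidableEq, Fintype

/-- Name of a qubit, as a list of numbers. -/
def Wire.code {n p a : ℕ} : Wire n p a → List ℕ
  | .input i => [0, i]
  | .data k i => [1, k, i]
  | .label k => [2, k]
  | .ancilla i => [3, i]

/-- Name of a gate, as a list of numbers. -/
def Gate.code {n p a : ℕ} : Gate (Wire n p a) → List ℕ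
  | .hadamard i => 0 :: i.code
  | .phaseT i => 1 :: i.code
  | .not i => 2 :: i.code
  | .cnot c t _ => 3 :: (c.code ++ t.code)
  | .toffoli c₁ c₂ t _ _ _ => 4 :: (c₁.code ++ c₂.code ++ t.code)

/-- A list of numbers as a bit string: each number `m` is written as `m` ones followed by a
zero. -/
def bitsOfList (l : List ℕ) : List Bool :=
  l.flatMap fun m => List.replicate m true ++ [false]

/-- A circuit for inputs of length `n` with `p` copies of the example state: a number of ancilla
qubits, a list of gates, and the qubit which is measured at the end. -/
structure AdviceCircuit (n p : ℕ) : Type where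
  ancillas : ℕ
  gates : List (Gate (Wire n p ancillas))
  output : Wire n p ancillas

/-- The description of a circuit as a bit string. -/
def AdviceCircuit.describe {n p : ℕ} (C : AdviceCircuit n p) : List Bool :=
  bitsOfList (C.ancillas :: (C.output.code ++ C.gates.flatMap Gate.code))

/-- A quantum polynomial-time algorithm with quantum sampling advice: a polynomial giving the
number of copies of the example state, and a family of circuits, one for each input length `n`,
whose descriptions are produced by a deterministic Turing machine from `n` in unary, in time
polynomial in `n`. -/
structure QAlgorithm where
  copies : Polynomial ℕ
  circuit : (n : ℕ) → AdviceCircuit n (copies.eval n)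
  uniform : Nonempty (Turing.TM2ComputableInPolyTime Computability.unaryEncodeNat
    (id : List Bool → List Bool) (fun n => (circuit n).describe))

/-! ### Quantum sampling advice -/

/-- A sequence `D` in which `D n` is a probability distribution over `{0,1}^n`. -/
abbrev DistSeq : Type := (n : ℕ) → PMF (Fin n → Bool)

open Classical in
/-- The bit telling whether the string `x` belongs to the language `L`. -/
noncomputable def memBit (L : Language Bool) {n : ℕ} (x : Fin n → Bool) : Bool :=
  decide (List.ofFn x ∈ L)

/-- The amplitude at `|y⟩|b⟩` of the example state `∑ y, √(D n y) |y⟩|L(y)⟩`. -/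
noncomputable def exampleAmp (D : DistSeq) (L : Language Bool) {n : ℕ} (y : Fin n → Bool)
    (b : Bool) : ℂ :=
  if b = memBit L y then ((Real.sqrt (D n y).toReal : ℝ) : ℂ) else 0

/-- The initial state: the input register holds `|x⟩`, the advice registers hold `p` copies of the
example state of `D` and `L`, and the ancillas are `|0⟩`. -/
noncomputable def initState (D : DistSeq) (L : Language Bool) {n : ℕ} (x : Fin n → Bool)
    (p a : ℕ) : QState (Wire n p a) := fun c =>
  if (∀ i, c (.input i) = x i) ∧ (∀ i, c (.ancilla i) = false) then
    ∏ k : Fin p, exampleAmp D L (fun i => c (.data k i)) (c (.label k))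
  else 0

/-- The probability that the algorithm `A`, on input `x` and with copies of the example state of
`D` and `L` as advice, outputs the bit `b`. -/
noncomputable def QAlgorithm.outputProb (A : QAlgorithm) (D : DistSeq) (L : Language Bool) {n : ℕ}
    (x : Fin n → Bool) (b : Bool) : ℝ :=
  measureProb
    (runGates (A.circuit n).gates (initState D L x (A.copies.eval n) (A.circuit n).ancillas))
    (A.circuit n).output b

/-- `A` decides `L`, with error probability at most `1/3` on every input, when the advice is
quantum sampling advice for `L` with distributions `D`. -/
def QAlgorithm.Decides (A : QAlgorithm) (D : DistSeq) (L : Language Bool) : Prop :=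
  ∀ (n : ℕ) (x : Fin n → Bool), 2 / 3 ≤ A.outputProb D L x (memBit L x)

/-- The class **BQP/qsamp**(`D`): the sequence of distributions is fixed. -/
def BQPqsampFixed (D : DistSeq) : Set (Language Bool) :=
  {L | ∃ A : QAlgorithm, A.Decides D L}

/-- The class **BQP/qsamp**: the sequence of distributions may depend on the language. -/
def BQPqsamp : Set (Language Bool) :=
  {L | ∃ (A : QAlgorithm) (D : DistSeq), A.Decides D L}

/-! The inclusion holds because the distributions may be chosen to be `D`. It is proper because the
sparse languages, with at most one string of each length, all belong to `BQPqsamp`, while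
diagonalization gives one outside `BQPqsampFixed D`.

A sparse language has good advice: let the distribution on strings of length `n` be the point mass
on the string `y` of that length in the language (on any string if there is none). A single copy of
the example state is then the basis state `|y⟩|b⟩`, and the circuit which computes `b ∧ x = y` from
the input `x` decides the language (`sparseLanguage_mem_BQPqsamp`). That the circuits are uniform is
shown by a stack machine which writes their descriptions (`EqualityTest.computable_testCode`).

With a fixed `D`, choose for each `n` a string `x` of probability at most `2 ^ (-n)`. The initial
states for the empty set and for `{x}` have inner product `(1 - D n x) ^ p` for `p` copies, so their
squared distance is at most `2 p / 2 ^ n` (`sum_norm_sq_initState_sub`). Circuits preserve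
distances, so an algorithm cannot be right on `x` in both cases once `2 ^ n` is large compared to
`p` (`exists_sparse_failure`). There are only countably many algorithms (`countable_qAlgorithm`): a
circuit is determined by its description, and up to renaming there are countably many machines
producing descriptions (`TM2Code.countable_computable`). So each algorithm can be given an input
length of its own, at which a sparse language makes it fail. -/

/-! ### Descriptions as bit strings -/

lemma bitsOfList_nil : bitsOfList [] = [] := rfl

lemma bitsOfList_append (l l' : List ℕ) : bitsOfList (l ++ l') = bitsOfList l ++ bitsOfList l' := by
  simp [bitsOfList]

lemma bitsOfList_cons (m : ℕ) (l : List ℕ) :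
    bitsOfList (m :: l) = List.replicate m true ++ false :: bitsOfList l := by
  simp [bitsOfList]

lemma bitsOfList_injective : Function.Injective bitsOfList := by
  intro l
  induction l with
  | nil =>
    intro l' h
    cases l' with
    | nil => rfl
    | cons m l' => simp [bitsOfList] at h
  | cons m l ih =>
    intro l' h
    cases l' with
    | nil => simp [bitsOfList] at h
    | cons m' l' =>
      rw [bitsOfList_cons, bitsOfList_cons] at h
      have key : ∀ m m' : ℕ, ∀ u u' : List Bool, List.replicate m true ++ false :: u =
          List.replicate m' true ++ false :: u' → m = m' ∧ u = u' := by
        intro m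
        induction m with
        | zero =>
          rintro (_ | m') u u' h
          · simpa using h
          · simp [List.replicate_succ] at h
        | succ m ihm =>
          rintro (_ | m') u u' h
          · simp [List.replicate_succ] at h
          · simp only [List.replicate_succ, List.cons_append, List.cons.injEq, true_and] at h
            simpa using ihm m' u u' h
      obtain ⟨rfl, h'⟩ := key _ _ _ _ h
      rw [ih h']

/-! ### Gates which permute the basis states -/

/-- The computational basis state `|c⟩`. -/
noncomputable def basisState {ι : Type} [DecidableEq (ι → Bool)] (c : ι → Bool) : QState ι :=
  fun c' => if c' = c then 1 else 0

/-- The effect of a gate on the bits of a basis state, for the gates NOT, CNOT and Toffoli. For the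
gates Hadamard and `T`, which do not permute the basis states, it is defined as the identity. -/
def Gate.actBits {ι : Type} [DecidableEq ι] : Gate ι → (ι → Bool) → (ι → Bool)
  | .hadamard _, c => c
  | .phaseT _, c => c
  | .not i, c => Function.update c i (!(c i))
  | .cnot a t _, c => Function.update c t (xor (c t) (c a))
  | .toffoli a b t _ _ _, c => Function.update c t (xor (c t) (c a && c b))

/-- The gates NOT, CNOT and Toffoli. -/
def Gate.IsClassical {ι : Type} : Gate ι → Prop
  | .hadamard _ => False
  | .phaseT _ => False
  | .not _ => True
  | .cnot _ _ _ => True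
  | .toffoli _ _ _ _ _ _ => True

lemma Gate.actBits_involutive {ι : Type} [DecidableEq ι] (g : Gate ι) :
    Function.Involutive (Gate.actBits g) := by
  intro c
  cases g with
  | hadamard i => rfl
  | phaseT i => rfl
  | not i => simp [Gate.actBits]
  | cnot a t h => simp [Gate.actBits, Function.update_of_ne h]
  | toffoli a b t h h₁ h₂ => simp [Gate.actBits, Function.update_of_ne h₁, Function.update_of_ne h₂]

lemma Gate.apply_eq_comp_actBits {ι : Type} [DecidableEq ι] (g : Gate ι) (hg : Gate.IsClassical g)
    (ψ : QState ι) : g.apply ψ = ψ ∘ Gate.actBits g := by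
  cases g with
  | hadamard i => exact hg.elim
  | phaseT i => exact hg.elim
  | _ => rfl

lemma Gate.apply_basisState {ι : Type} [DecidableEq ι] [DecidableEq (ι → Bool)] (g : Gate ι)
    (hg : Gate.IsClassical g) (c : ι → Bool) :
    g.apply (basisState c) = basisState (Gate.actBits g c) := by
  funext c'
  have h : Gate.actBits g c' = c ↔ c' = Gate.actBits g c :=
    ⟨fun h => by rw [← h, Gate.actBits_involutive g], fun h => by rw [h, Gate.actBits_involutive g]⟩
  simp [Gate.apply_eq_comp_actBits g hg, basisState, h]

lemma measureProb_basisState {ι : Type} [Fintype ι] [DecidableEq ι] (c : ι → Bool) (o : ι)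
    (b : Bool) : measureProb (basisState c) o b = if c o = b then 1 else 0 := by
  unfold measureProb basisState
  rw [Finset.sum_eq_single c] <;> simp +contextual

lemma runGates_append {ι : Type} [DecidableEq ι] (gs gs' : List (Gate ι)) (ψ : QState ι) :
    runGates (gs ++ gs') ψ = runGates gs' (runGates gs ψ) :=
  List.foldl_append

/-! ### A Turing machine writing the equality test -/

namespace EqualityTest

/-- The numbers describing the three gates which compare bit `i` of the input with bit `i` of the
example and update the running conjunction. -/
def blockCode (i : ℕ) : List ℕ :=
  [3, 1, 0, i, 0, i, 2, 0, i, 4, 3, i, 0, i, 3, i + 1]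

/-- The numbers describing the equality test on inputs of length `n`: the number of ancillas, the
output qubit, the gate which copies the label to the first ancilla, and the blocks. -/
def testCode (n : ℕ) : List ℕ :=
  (n + 1) :: 3 :: n :: 3 :: 2 :: 0 :: 3 :: 0 :: (List.range n).flatMap blockCode

/-- The stacks of the machine. -/
inductive Stack : Type
  | inp
  | out
  | tmp
  | save
  deriving DecidableEq

instance : Fintype Stack := ⟨{.inp, .out, .tmp, .save}, fun k => by cases k <;> simp⟩

/-- The labels of the machine: `next` starts the block of the next index, `copy j` copies that
index to the output for the `j`-th time, `header` and `finish` write the length of the input in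
front of the blocks. -/
inductive Label : Type
  | next
  | copy (j : Fin 6)
  | header
  | finish
  deriving DecidableEq, Fintype

/-- Statements of the machine. -/
abbrev TMStmt : Type := Turing.TM2.Stmt (fun _ : Stack => Bool) Label (Option Bool)

/-- Configurations of the machine. -/
abbrev TMCfg : Type := Turing.TM2.Cfg (fun _ : Stack => Bool) Label (Option Bool)

open Turing.TM2.Stmt

/-- Put the word `w` on top of the output stack. -/
def pushOut : List Bool → TMStmt → TMStmt
  | [], q => q
  | b :: w, q => pushOut w (push .out (fun _ => b) q)

/-- Pop a symbol from the stack `k`, and execute `q₁` if there was one and `q₂` if not. -/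
def popCases (k : Stack) (q₁ q₂ : TMStmt) : TMStmt :=
  pop k (fun _ s => s) (branch Option.isSome q₁ q₂)

/-- The word written between two consecutive copies of the index of a block, counted from the end
of the block. -/
def separator : Fin 6 → List Bool :=
  ![false :: bitsOfList [3], false :: bitsOfList [0], false :: bitsOfList [4, 3],
    false :: bitsOfList [2, 0], false :: bitsOfList [0], bitsOfList [3, 1, 0]]

/-- The label after `copy j`. -/
def afterCopy : Fin 6 → Label :=
  ![.copy 1, .copy 2, .copy 3, .copy 4, .copy 5, .next]

/-- The stack from which the `j`-th copy is made. -/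
def copySource : Fin 6 → Stack := ![.inp, .tmp, .inp, .tmp, .inp, .tmp]

/-- The stack to which the symbols of the `j`-th copy are moved. -/
def copyTarget : Fin 6 → Stack := ![.tmp, .inp, .tmp, .inp, .tmp, .inp]

/-- The program of the machine. Since the output is a stack, it is written from its end. -/
def program : Label → TMStmt
  | .next => popCases .inp
      (push .save (fun _ => true) (pushOut [true, false] (goto fun _ => .copy 0)))
      (pushOut (false :: bitsOfList [3, 2, 0, 3, 0]) (goto fun _ => .header))
  | .copy j => popCases (copySource j)
      (push (copyTarget j) (fun _ => true) (push .out (fun _ => true) (goto fun _ => .copy j)))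
      (pushOut (separator j) (goto fun _ => afterCopy j))
  | .header => popCases .save
      (push .inp (fun _ => true) (push .out (fun _ => true) (goto fun _ => .header)))
      (pushOut (true :: false :: bitsOfList [3]) (goto fun _ => .finish))
  | .finish => popCases .inp (push .out (fun _ => true) (goto fun _ => .finish)) halt

/-- The stack contents with `a`, `c`, `d` symbols on the stacks `inp`, `tmp`, `save` and the word
`w` on the output stack. -/
def contents (a : ℕ) (w : List Bool) (c d : ℕ) : Stack → List Bool
  | .inp => List.replicate a true
  | .out => w
  | .tmp => List.replicate c true
  | .save => List.replicate d true

@[simp] lemma update_contents_inp (a b : ℕ) (w : List Bool) (c d : ℕ) :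
    Function.update (contents a w c d) .inp (List.replicate b true) = contents b w c d := by
  funext k; cases k <;> simp [contents]

@[simp] lemma update_contents_out (a : ℕ) (w w' : List Bool) (c d : ℕ) :
    Function.update (contents a w c d) .out w' = contents a w' c d := by
  funext k; cases k <;> simp [contents]

@[simp] lemma update_contents_tmp (a b : ℕ) (w : List Bool) (c d : ℕ) :
    Function.update (contents a w c d) .tmp (List.replicate b true) = contents a w b d := by
  funext k; cases k <;> simp [contents]

@[simp] lemma update_contents_save (a b : ℕ) (w : List Bool) (c d : ℕ) :
    Function.update (contents a w c d) .save (List.replicate b true) = contents a w c b := by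
  funext k; cases k <;> simp [contents]

@[simp] lemma stepAux_pushOut (w : List Bool) (q : TMStmt) (v : Option Bool)
    (S : Stack → List Bool) :
    Turing.TM2.stepAux (pushOut w q) v S =
      Turing.TM2.stepAux q v (Function.update S .out (w ++ S .out)) := by
  induction w generalizing q S with
  | nil => simp [pushOut]
  | cons b w ih => simp [pushOut, ih]

/-- The machine gets from `x` to `y` in `t` steps. -/
def RunsIn (t : ℕ) (x y : TMCfg) : Prop :=
  (flip bind (Turing.TM2.step program))^[t] (some x) = some y

lemma RunsIn.trans {s t : ℕ} {x y z : TMCfg} (h₁ : RunsIn s x y) (h₂ : RunsIn t y z) :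
    RunsIn (s + t) x z := by
  unfold RunsIn at *
  rw [add_comm, Function.iterate_add_apply, h₁, h₂]

lemma RunsIn.refl (x : TMCfg) : RunsIn 0 x x := rfl

lemma RunsIn.step {t : ℕ} {l : Label} {v : Option Bool} {S : Stack → List Bool} {y : TMCfg}
    (h : RunsIn t (Turing.TM2.stepAux (program l) v S) y) : RunsIn (t + 1) ⟨some l, v, S⟩ y := by
  rw [add_comm]
  exact RunsIn.trans (s := 1) rfl h

lemma stepAux_popCases_inp (q₁ q₂ : TMStmt) (v : Option Bool) (a : ℕ) (w : List Bool) (c d : ℕ) :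
    Turing.TM2.stepAux (popCases .inp q₁ q₂) v (contents (a + 1) w c d) =
      Turing.TM2.stepAux q₁ (some true) (contents a w c d) := by
  simp [popCases, contents, List.replicate_succ]

lemma stepAux_popCases_tmp (q₁ q₂ : TMStmt) (v : Option Bool) (a : ℕ) (w : List Bool) (c d : ℕ) :
    Turing.TM2.stepAux (popCases .tmp q₁ q₂) v (contents a w (c + 1) d) =
      Turing.TM2.stepAux q₁ (some true) (contents a w c d) := by
  simp [popCases, contents, List.replicate_succ]

lemma stepAux_popCases_save (q₁ q₂ : TMStmt) (v : Option Bool) (a : ℕ) (w : List Bool) (c d : ℕ) :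
    Turing.TM2.stepAux (popCases .save q₁ q₂) v (contents a w c (d + 1)) =
      Turing.TM2.stepAux q₁ (some true) (contents a w c d) := by
  simp [popCases, contents, List.replicate_succ]

lemma stepAux_popCases_of_nil (k : Stack) (q₁ q₂ : TMStmt) (v : Option Bool)
    (S : Stack → List Bool) (h : S k = []) :
    Turing.TM2.stepAux (popCases k q₁ q₂) v S = Turing.TM2.stepAux q₂ none S := by
  have : Function.update S k [] = S := by rw [← h, Function.update_eq_self]
  simp [popCases, h, this]

lemma update_replicate_succ (k : Stack) (S : Stack → List Bool) (a : ℕ)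
    (h : S k = List.replicate a true) :
    Function.update S k (true :: S k) = Function.update S k (List.replicate (a + 1) true) := by
  rw [h, List.replicate_succ]

/-- A copy from `inp` to `tmp`. -/
lemma runsIn_copy_even (j : Fin 6) (hs : copySource j = .inp) (ht : copyTarget j = .tmp)
    (a : ℕ) (v : Option Bool) (w : List Bool) (c d : ℕ) :
    RunsIn (a + 1) ⟨some (.copy j), v, contents a w c d⟩
      ⟨some (afterCopy j), none,
        contents 0 (separator j ++ (List.replicate a true ++ w)) (c + a) d⟩ := by
  induction a generalizing v w c with
  | zero =>
    apply RunsIn.step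
    rw [program, hs, stepAux_popCases_of_nil _ _ _ _ _ rfl]
    simp [RunsIn.refl, contents]
  | succ a ih =>
    apply RunsIn.step
    rw [program, hs, ht, stepAux_popCases_inp, Turing.TM2.stepAux,
      update_replicate_succ _ _ c rfl, update_contents_tmp]
    have h := ih (some true) (true :: w) (c + 1)
    have e : List.replicate (a + 1) true ++ w = List.replicate a true ++ true :: w := by
      rw [List.replicate_succ', List.append_assoc, List.singleton_append]
    rw [e, show c + (a + 1) = c + 1 + a by ring]
    simpa [contents] using h

/-- A copy from `tmp` to `inp`. -/
lemma runsIn_copy_odd (j : Fin 6) (hs : copySource j = .tmp) (ht : copyTarget j = .inp)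
    (c : ℕ) (v : Option Bool) (w : List Bool) (a d : ℕ) :
    RunsIn (c + 1) ⟨some (.copy j), v, contents a w c d⟩
      ⟨some (afterCopy j), none,
        contents (a + c) (separator j ++ (List.replicate c true ++ w)) 0 d⟩ := by
  induction c generalizing v w a with
  | zero =>
    apply RunsIn.step
    rw [program, hs, stepAux_popCases_of_nil _ _ _ _ _ rfl]
    simp [RunsIn.refl, contents]
  | succ c ih =>
    apply RunsIn.step
    rw [program, hs, ht, stepAux_popCases_tmp, Turing.TM2.stepAux,
      update_replicate_succ _ _ a rfl, update_contents_inp]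
    have h := ih (some true) (true :: w) (a + 1)
    have e : List.replicate (c + 1) true ++ w = List.replicate c true ++ true :: w := by
      rw [List.replicate_succ', List.append_assoc, List.singleton_append]
    rw [e, show a + (c + 1) = a + 1 + c by ring]
    simpa [contents] using h

lemma runsIn_header (d : ℕ) (v : Option Bool) (w : List Bool) (a : ℕ) :
    RunsIn (d + 1) ⟨some .header, v, contents a w 0 d⟩
      ⟨some .finish, none, contents (a + d)
        (true :: false :: bitsOfList [3] ++ (List.replicate d true ++ w)) 0 0⟩ := by
  induction d generalizing v w a with
  | zero =>
    apply RunsIn.step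
    rw [program, stepAux_popCases_of_nil _ _ _ _ _ rfl]
    simp [RunsIn.refl, contents]
  | succ d ih =>
    apply RunsIn.step
    rw [program, stepAux_popCases_save, Turing.TM2.stepAux,
      update_replicate_succ _ _ a rfl, update_contents_inp]
    have h := ih (some true) (true :: w) (a + 1)
    have e : List.replicate (d + 1) true ++ w = List.replicate d true ++ true :: w := by
      rw [List.replicate_succ', List.append_assoc, List.singleton_append]
    rw [e, show a + (d + 1) = a + 1 + d by ring]
    simpa [contents] using h

lemma runsIn_finish (a : ℕ) (v : Option Bool) (w : List Bool) :
    RunsIn (a + 1) ⟨some .finish, v, contents a w 0 0⟩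
      ⟨none, none, contents 0 (List.replicate a true ++ w) 0 0⟩ := by
  induction a generalizing v w with
  | zero =>
    apply RunsIn.step
    rw [program, stepAux_popCases_of_nil _ _ _ _ _ rfl]
    simp [RunsIn.refl]
  | succ a ih =>
    apply RunsIn.step
    rw [program, stepAux_popCases_inp]
    have h := ih (some true) (true :: w)
    have e : List.replicate (a + 1) true ++ w = List.replicate a true ++ true :: w := by
      rw [List.replicate_succ', List.append_assoc, List.singleton_append]
    rw [e]
    simpa [contents] using h

lemma runsIn_block (i : ℕ) (v : Option Bool) (w : List Bool) (d : ℕ) :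
    RunsIn (6 * i + 7) ⟨some .next, v, contents (i + 1) w 0 d⟩
      ⟨some .next, none, contents i (bitsOfList (blockCode i) ++ w) 0 (d + 1)⟩ := by
  -- One step to start the block, and six copies of `i + 1` steps each.
  have e : 6 * i + 7 =
      (i + 1 + ((i + 1) + ((i + 1) + ((i + 1) + ((i + 1) + (i + 1)))))) + 1 := by ring
  rw [e]
  apply RunsIn.step
  rw [program, stepAux_popCases_inp, Turing.TM2.stepAux, update_replicate_succ _ _ d rfl,
    update_contents_save, stepAux_pushOut, update_contents_out, Turing.TM2.stepAux]
  refine (runsIn_copy_even 0 rfl rfl _ _ _ _ _).trans ?_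
  simp only [zero_add]
  refine (runsIn_copy_odd 1 rfl rfl _ _ _ _ _).trans ?_
  simp only [zero_add]
  refine (runsIn_copy_even 2 rfl rfl _ _ _ _ _).trans ?_
  simp only [zero_add]
  refine (runsIn_copy_odd 3 rfl rfl _ _ _ _ _).trans ?_
  simp only [zero_add]
  refine (runsIn_copy_even 4 rfl rfl _ _ _ _ _).trans ?_
  simp only [zero_add]
  convert runsIn_copy_odd 5 rfl rfl _ _ _ _ _ using 3
  · rfl
  · rfl
  · rw [zero_add]
  · simp [blockCode, bitsOfList_cons, bitsOfList_nil, separator, contents, List.replicate_succ']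

lemma runsIn_blocks (i : ℕ) (v : Option Bool) (w : List Bool) (d : ℕ) :
    ∃ t v', t ≤ i * (6 * i + 7) ∧ RunsIn t ⟨some .next, v, contents i w 0 d⟩
      ⟨some .next, v',
        contents 0 (bitsOfList ((List.range i).flatMap blockCode) ++ w) 0 (d + i)⟩ := by
  induction i generalizing v w d with
  | zero => exact ⟨0, v, by simp, by simp [RunsIn.refl, bitsOfList]⟩
  | succ i ih =>
    obtain ⟨t, v', ht, h⟩ := ih none (bitsOfList (blockCode i) ++ w) (d + 1)
    refine ⟨6 * i + 7 + t, v', by nlinarith, ?_⟩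
    have := (runsIn_block i v w d).trans h
    convert this using 3
    · simp [List.range_succ, bitsOfList_append]
    · ring

lemma runsIn_test (n : ℕ) :
    ∃ t ≤ n * (6 * n + 7) + 2 * n + 3, RunsIn t ⟨some .next, none, contents n [] 0 0⟩
      ⟨none, none, contents 0 (bitsOfList (testCode n)) 0 0⟩ := by
  obtain ⟨t, v', ht, h⟩ := runsIn_blocks n none [] 0
  refine ⟨t + ((n + 1 + (n + 1)) + 1), by omega, h.trans (RunsIn.step ?_)⟩
  rw [program, stepAux_popCases_of_nil _ _ _ _ _ rfl, stepAux_pushOut, update_contents_out,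
    Turing.TM2.stepAux, zero_add]
  refine (runsIn_header _ _ _ _).trans ?_
  convert runsIn_finish _ _ _ using 3
  · ring
  · simp [testCode, bitsOfList_cons, bitsOfList_nil, contents, List.replicate_succ']

/-- The machine as a bundled machine with finitely many stacks, labels and states. -/
def machine : Turing.FinTM2 where
  K := Stack
  k₀ := .inp
  k₁ := .out
  Γ _ := Bool
  Λ := Label
  main := .next
  σ := Option Bool
  initialState := none
  Γk₀Fin := inferInstanceAs (Fintype Bool)
  m := program

lemma unaryEncodeNat_eq (n : ℕ) : Computability.unaryEncodeNat n = List.replicate n true := by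
  induction n with
  | zero => rfl
  | succ n ih => rw [Computability.unaryEncodeNat, ih, List.replicate_succ]

lemma computable_testCode :
    Nonempty (Turing.TM2ComputableInPolyTime Computability.unaryEncodeNat
      (id : List Bool → List Bool) (fun n => bitsOfList (testCode n))) := by
  choose t ht h using runsIn_test
  refine ⟨⟨⟨machine, Equiv.refl Bool, Equiv.refl Bool⟩,
    .X * (6 * .X + 7) + 2 * .X + 3, fun n => ⟨⟨t n, ?_⟩, ?_⟩⟩⟩
  · have e₁ : Turing.initList machine (List.map (Equiv.refl Bool).invFun
        (Computability.unaryEncodeNat n)) = ⟨some .next, none, contents n [] 0 0⟩ := by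
      rw [unaryEncodeNat_eq]
      simp only [Turing.initList]
      congr 1
      funext k
      cases k
      · exact (List.map_id _)
      all_goals rfl
    have e₂ : Turing.haltList machine (List.map (Equiv.refl Bool).invFun
        (bitsOfList (testCode n))) = ⟨none, none, contents 0 (bitsOfList (testCode n)) 0 0⟩ := by
      simp only [Turing.haltList]
      congr 1
      funext k
      cases k
      · rfl
      · exact (List.map_id _)
      all_goals rfl
    exact (congrArg (fun x => (flip bind (Turing.TM2.step program))^[t n] (some x)) e₁).trans
      (Eq.trans (h n) (congrArg some e₂.symm))
  · have e : (Computability.unaryEncodeNat n).length = n := by simp [unaryEncodeNat_eq]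
    simpa [e] using ht n

end EqualityTest

/-! ### The equality test as a quantum circuit -/

namespace EqualityTest

/-- The three gates for index `i`: input bit `i` becomes the truth value of `xᵢ = yᵢ`, where `y` is
the example in copy `k`, and ancilla `i + 1` becomes its conjunction with ancilla `i`. -/
def block {n p : ℕ} (k : Fin p) (i : Fin n) : List (Gate (Wire n p (n + 1))) :=
  [.cnot (.data k i) (.input i) (by simp), .not (.input i),
    .toffoli (.ancilla i.castSucc) (.input i) (.ancilla i.succ) (by simp)
      (by simp [Fin.ext_iff]) (by simp)]

/-- The circuit computing `b ∧ x = y`, where `x` is the input and `(y, b)` is the labelled example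
in copy `k`. -/
def testCircuit (n : ℕ) {p : ℕ} (k : Fin p) : AdviceCircuit n p where
  ancillas := n + 1
  gates := .cnot (.label k) (.ancilla 0) (by simp) :: (List.finRange n).flatMap (block k)
  output := .ancilla (Fin.last n)

lemma describe_testCircuit (n : ℕ) {p : ℕ} (k : Fin p) (hk : (k : ℕ) = 0) :
    (testCircuit n k).describe = bitsOfList (testCode n) := by
  have h : ∀ i : Fin n, (block k i).flatMap Gate.code = blockCode i := fun i => by
    simp [block, Gate.code, Wire.code, blockCode, hk]
  have h' : ((List.finRange n).flatMap (block k)).flatMap Gate.code =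
      (List.range n).flatMap blockCode := by
    rw [List.flatMap_assoc, ← List.map_coe_finRange_eq_range, List.flatMap_map]
    simp only [h]
  simp [AdviceCircuit.describe, testCircuit, testCode, h', Gate.code, Wire.code, hk]

/-- The contents of the qubits after the blocks for the indices below `m`, when the input is `x`
and the copies of the example state are in the basis states `|y k⟩|b k⟩`. -/
def bitsAfter {n p : ℕ} (x : Fin n → Bool) (y : Fin p → Fin n → Bool) (b : Fin p → Bool)
    (k : Fin p) (m : ℕ) : Wire n p (n + 1) → Bool
  | .input i => if (i : ℕ) < m then x i == y k i else x i
  | .data k' i => y k' i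
  | .label k' => b k'
  | .ancilla i =>
    if (i : ℕ) ≤ m then b k && decide (∀ j : Fin n, (j : ℕ) < i → x j = y k j) else false

lemma runGates_block {n p : ℕ} (x : Fin n → Bool) (y : Fin p → Fin n → Bool) (b : Fin p → Bool)
    (k : Fin p) (i : Fin n) :
    runGates (block k i) (basisState (bitsAfter x y b k i)) =
      basisState (bitsAfter x y b k (i + 1)) := by
  simp only [runGates, block, List.foldl]
  rw [Gate.apply_basisState (.cnot _ _ _) trivial, Gate.apply_basisState (.not _) trivial,
    Gate.apply_basisState (.toffoli _ _ _ _ _ _) trivial]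
  congr 1
  simp only [Gate.actBits]
  have key : (∀ j ≤ i, x j = y k j) ↔ (∀ j < i, x j = y k j) ∧ x i = y k i := by
    refine ⟨fun h => ⟨fun j hj => h j hj.le, h i le_rfl⟩, fun h j hj => ?_⟩
    rcases hj.lt_or_eq with hj | rfl
    · exact h.1 j hj
    · exact h.2
  funext w
  cases w with
  | input j =>
    by_cases hj : j = i
    · subst hj
      simp [bitsAfter]
      cases x j <;> cases y k j <;> rfl
    · have hj' : (j : ℕ) ≠ i := fun h => hj (Fin.ext h)
      have : (j : ℕ) < i + 1 ↔ (j : ℕ) < i := by omega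
      simp [bitsAfter, hj, this]
  | data k' j => simp [bitsAfter]
  | label k' => simp [bitsAfter]
  | ancilla j =>
    by_cases hj : j = i.succ
    · subst hj
      simp [bitsAfter, key]
      cases x i <;> cases y k i <;> simp
    · have hj' : (j : ℕ) ≠ i + 1 := fun h => hj (Fin.ext (by simpa using h))
      have : (j : ℕ) ≤ i + 1 ↔ (j : ℕ) ≤ i := by omega
      simp [bitsAfter, hj, this]

lemma runGates_blocks {n p : ℕ} (x : Fin n → Bool) (y : Fin p → Fin n → Bool) (b : Fin p → Bool)
    (k : Fin p) (m : ℕ) (hm : m ≤ n) :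
    runGates (((List.finRange n).take m).flatMap (block k)) (basisState (bitsAfter x y b k 0)) =
      basisState (bitsAfter x y b k m) := by
  induction m with
  | zero => simp [runGates]
  | succ m ih =>
    rw [List.take_succ_eq_append_getElem (by simpa using hm), List.flatMap_append,
      runGates_append, ih (by omega)]
    simpa using runGates_block x y b k ⟨m, hm⟩

lemma runGates_testCircuit {n p : ℕ} (x : Fin n → Bool) (y : Fin p → Fin n → Bool)
    (b : Fin p → Bool) (k : Fin p) (c : Wire n p (n + 1) → Bool) (hx : ∀ i, c (.input i) = x i)
    (hy : ∀ k' i, c (.data k' i) = y k' i) (hb : ∀ k', c (.label k') = b k')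
    (ha : ∀ i, c (.ancilla i) = false) :
    runGates (testCircuit n k).gates (basisState c) = basisState (bitsAfter x y b k n) := by
  have h₀ : Gate.actBits (.cnot (.label k) (.ancilla 0) (by simp)) c = bitsAfter x y b k 0 := by
    funext w
    cases w with
    | input i => simp [Gate.actBits, bitsAfter, hx]
    | data k' i => simp [Gate.actBits, bitsAfter, hy]
    | label k' => simp [Gate.actBits, bitsAfter, hb]
    | ancilla i =>
      by_cases hi : i = 0
      · subst hi
        simp [Gate.actBits, bitsAfter, ha, hb]
      · simp [Gate.actBits, bitsAfter, ha, hi]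
  have h := runGates_blocks x y b k n le_rfl
  rw [List.take_of_length_le (by simp), ← h₀, ← Gate.apply_basisState (.cnot _ _ _) trivial] at h
  exact h

/-- The algorithm which tests whether the input equals a single copy of the example, and the
example has label `1`. -/
noncomputable def algorithm : QAlgorithm where
  copies := 1
  circuit n := testCircuit n ⟨0, by simp⟩
  uniform := by
    have h : (fun n => (testCircuit n (⟨0, by simp⟩ : Fin ((1 : Polynomial ℕ).eval n))).describe) =
        fun n => bitsOfList (testCode n) := funext fun n => describe_testCircuit n _ rfl
    rw [h]
    exact computable_testCode

/-- When the distribution is concentrated on one string `y`, the initial state is a basis state. -/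
lemma initState_pure (D : DistSeq) (L : Language Bool) {n : ℕ} (x y : Fin n → Bool)
    (hD : D n = PMF.pure y) (p a : ℕ) (c : Wire n p a → Bool) (hx : ∀ i, c (.input i) = x i)
    (hy : ∀ k i, c (.data k i) = y i) (hb : ∀ k, c (.label k) = memBit L y)
    (ha : ∀ i, c (.ancilla i) = false) :
    initState D L x p a = basisState c := by
  funext c'
  unfold initState basisState
  by_cases h : c' = c
  · subst h
    rw [if_pos ⟨hx, ha⟩, if_pos rfl]
    refine Finset.prod_eq_one fun k _ => ?_
    have : (fun i => c' (.data k i)) = y := funext (hy k)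
    simp [exampleAmp, this, hb, hD]
  · rw [if_neg h]
    by_contra hne
    rw [ite_eq_right_iff, Classical.not_imp] at hne
    obtain ⟨⟨hx', ha'⟩, hne⟩ := hne
    have hne' := fun k => Finset.prod_ne_zero_iff.1 hne k (Finset.mem_univ k)
    have hy' : ∀ k, (fun i => c' (.data k i)) = y := fun k => by
      by_contra hk
      exact hne' k (by simp [exampleAmp, hD, PMF.pure_apply, hk])
    have hb' : ∀ k, c' (.label k) = memBit L y := fun k => by
      by_contra hk
      exact hne' k (by simp [exampleAmp, hy', hk])
    apply h
    funext w
    cases w with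
    | input i => rw [hx, hx']
    | data k i => rw [hy, ← hy' k]
    | label k => rw [hb, hb']
    | ancilla i => rw [ha, ha']

lemma outputProb_algorithm (D : DistSeq) (L : Language Bool) {n : ℕ} (x y : Fin n → Bool)
    (hD : D n = PMF.pure y) :
    algorithm.outputProb D L x (memBit L y && decide (x = y)) = 1 := by
  let c : Wire n (algorithm.copies.eval n) (n + 1) → Bool
    | .input i => x i
    | .data _ i => y i
    | .label _ => memBit L y
    | .ancilla _ => false
  have hi : initState D L x (algorithm.copies.eval n) (n + 1) = basisState c :=
    initState_pure D L x y hD _ _ c (fun _ => rfl) (fun _ _ => rfl) (fun _ => rfl) (fun _ => rfl)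
  have hr := runGates_testCircuit x (fun _ => y) (fun _ => memBit L y)
    (⟨0, by simp [algorithm]⟩ : Fin (algorithm.copies.eval n)) c (fun _ => rfl) (fun _ _ => rfl)
    (fun _ => rfl) (fun _ => rfl)
  have hm := measureProb_basisState (bitsAfter x (fun _ => y) (fun _ => memBit L y)
    (⟨0, by simp [algorithm]⟩ : Fin (algorithm.copies.eval n)) n) (.ancilla (Fin.last n))
    (memBit L y && decide (x = y))
  refine (congrArg (fun ψ => measureProb ψ (.ancilla (Fin.last n)) _)
    ((congrArg (runGates _) hi).trans hr)).trans (hm.trans (if_pos ?_))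
  simp [bitsAfter, funext_iff]

end EqualityTest

/-- The language which contains, among the strings of length `n`, just the string `o n`, or none if
`o n = none`. -/
def sparseLanguage (o : ∀ n, Option (Fin n → Bool)) : Language Bool :=
  {w | ∃ n, ∃ y : Fin n → Bool, o n = some y ∧ w = List.ofFn y}

lemma memBit_sparseLanguage (o : ∀ n, Option (Fin n → Bool)) {n : ℕ} (x : Fin n → Bool) :
    memBit (sparseLanguage o) x = decide (o n = some x) := by
  have h : List.ofFn x ∈ sparseLanguage o ↔ o n = some x := by
    refine ⟨?_, fun h => ⟨n, x, h, rfl⟩⟩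
    rintro ⟨m, y, hy, h⟩
    rw [List.ofFn_inj'] at h
    cases h
    exact hy
  simp [memBit, h]

/-- Point masses on the strings of the language are the distributions from which the equality test
decides a sparse language. -/
lemma sparseLanguage_mem_BQPqsamp (o : ∀ n, Option (Fin n → Bool)) :
    sparseLanguage o ∈ BQPqsamp := by
  refine ⟨EqualityTest.algorithm, fun n => PMF.pure ((o n).getD fun _ => false), fun n x => ?_⟩
  have h := EqualityTest.outputProb_algorithm
    (fun n => PMF.pure ((o n).getD fun _ => false)) (sparseLanguage o) x _ rfl
  have e : (memBit (sparseLanguage o) ((o n).getD fun _ => false) &&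
      decide (x = (o n).getD fun _ => false)) = memBit (sparseLanguage o) x := by
    rw [memBit_sparseLanguage, memBit_sparseLanguage]
    cases o n with
    | none => simp
    | some y => simp [eq_comm]
  rw [e] at h
  rw [h]
  norm_num

/-! ### Examples with one rare string do not help -/

lemma sum_norm_sq_gate_apply {ι : Type} [Fintype ι] [DecidableEq ι] (g : Gate ι) (ψ : QState ι) :
    ∑ c, ‖g.apply ψ c‖ ^ 2 = ∑ c, ‖ψ c‖ ^ 2 := by
  have classical : Gate.IsClassical g → ∑ c, ‖g.apply ψ c‖ ^ 2 = ∑ c, ‖ψ c‖ ^ 2 :=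
    fun hg => by
      rw [Gate.apply_eq_comp_actBits g hg]
      exact Equiv.sum_comp (Gate.actBits_involutive g).toPerm (fun c => ‖ψ c‖ ^ 2)
  cases g with
  | not i => exact classical trivial
  | cnot a t h => exact classical trivial
  | toffoli a b t h h₁ h₂ => exact classical trivial
  | phaseT i =>
    refine Finset.sum_congr rfl fun c _ => ?_
    have h : ‖Complex.exp (Complex.I * (Real.pi / 4))‖ = 1 := by
      have := Complex.norm_exp_I_mul_ofReal (Real.pi / 4)
      simpa using this
    simp only [Gate.apply, norm_mul]
    split_ifs <;> simp [h]
  | hadamard i =>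
    -- Sum over the pairs of strings which differ only in bit `i`.
    let flip : (ι → Bool) → (ι → Bool) := Gate.actBits (.not i)
    have hsum : ∀ f : (ι → Bool) → ℝ, ∑ c, f (flip c) = ∑ c, f c := fun f =>
      Equiv.sum_comp (Gate.actBits_involutive (.not i)).toPerm f
    have hpair : ∀ c,
        ‖(Gate.hadamard i).apply ψ c‖ ^ 2 + ‖(Gate.hadamard i).apply ψ (flip c)‖ ^ 2 =
          ‖ψ c‖ ^ 2 + ‖ψ (flip c)‖ ^ 2 := fun c => by
      have hpar : ∀ a b : ℂ, ‖((Real.sqrt 2 : ℝ) : ℂ)⁻¹ * (a + b)‖ ^ 2 +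
          ‖((Real.sqrt 2 : ℝ) : ℂ)⁻¹ * (a - b)‖ ^ 2 = ‖a‖ ^ 2 + ‖b‖ ^ 2 := fun a b => by
        have hp := parallelogram_law_with_norm ℝ a b
        have h2 : ‖((Real.sqrt 2 : ℝ) : ℂ)⁻¹‖ ^ 2 = 1 / 2 := by
          simp [abs_of_nonneg]
        rw [norm_mul, norm_mul, mul_pow, mul_pow, h2]
        nlinarith
      cases hc : c i with
      | false =>
        have e : Function.update c i false = c := by rw [← hc, Function.update_eq_self]
        have := hpar (ψ c) (ψ (Function.update c i true))
        simpa [Gate.apply, flip, Gate.actBits, hc, e, sub_eq_add_neg] using this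
      | true =>
        have e : Function.update c i true = c := by rw [← hc, Function.update_eq_self]
        have := hpar (ψ (Function.update c i false)) (ψ c)
        simp [Gate.apply, flip, Gate.actBits, hc, e, ← sub_eq_add_neg]
        simp [-norm_mul] at this
        linarith
    have h := Finset.sum_congr (rfl : (Finset.univ : Finset (ι → Bool)) = _) fun c _ => hpair c
    rw [Finset.sum_add_distrib, Finset.sum_add_distrib,
      hsum fun c => ‖(Gate.hadamard i).apply ψ c‖ ^ 2, hsum fun c => ‖ψ c‖ ^ 2] at h
    linarith

lemma sum_norm_sq_runGates {ι : Type} [Fintype ι] [DecidableEq ι] (gs : List (Gate ι))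
    (ψ : QState ι) : ∑ c, ‖runGates gs ψ c‖ ^ 2 = ∑ c, ‖ψ c‖ ^ 2 := by
  induction gs generalizing ψ with
  | nil => rfl
  | cons g gs ih => exact (ih (g.apply ψ)).trans (sum_norm_sq_gate_apply g ψ)

lemma gate_apply_sub {ι : Type} [DecidableEq ι] (g : Gate ι) (ψ φ : QState ι) :
    g.apply (ψ - φ) = g.apply ψ - g.apply φ := by
  funext c
  cases g <;> simp only [Gate.apply, Pi.sub_apply]
  all_goals ring

lemma runGates_sub {ι : Type} [DecidableEq ι] (gs : List (Gate ι)) (ψ φ : QState ι) :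
    runGates gs (ψ - φ) = runGates gs ψ - runGates gs φ := by
  induction gs generalizing ψ φ with
  | nil => rfl
  | cons g gs ih =>
    have : runGates (g :: gs) (ψ - φ) = runGates gs (g.apply (ψ - φ)) := rfl
    rw [this, gate_apply_sub, ih]
    rfl

lemma measureProb_add {ι : Type} [Fintype ι] [DecidableEq ι] (ψ : QState ι) (o : ι) :
    measureProb ψ o true + measureProb ψ o false = ∑ c, ‖ψ c‖ ^ 2 := by
  unfold measureProb
  rw [← Finset.sum_add_distrib]
  refine Finset.sum_congr rfl fun c _ => ?_
  cases c o <;> simp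

/-- Measurement probabilities are stable under small changes of the state: a form of the triangle
inequality for the projection of the state to the measured outcome. -/
lemma measureProb_le {ι : Type} [Fintype ι] [DecidableEq ι] (ψ φ : QState ι) (o : ι) (b : Bool) :
    measureProb ψ o b ≤ 3 / 2 * measureProb φ o b + 3 * ∑ c, ‖ψ c - φ c‖ ^ 2 := by
  unfold measureProb
  rw [Finset.mul_sum, Finset.mul_sum, ← Finset.sum_add_distrib]
  refine Finset.sum_le_sum fun c _ => ?_
  split_ifs
  · have h : ‖ψ c‖ ≤ ‖φ c‖ + ‖ψ c - φ c‖ := by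
      simpa using norm_add_le (φ c) (ψ c - φ c)
    have h' : ‖ψ c‖ ^ 2 ≤ (‖φ c‖ + ‖ψ c - φ c‖) ^ 2 := by gcongr
    nlinarith [sq_nonneg (‖φ c‖ - 2 * ‖ψ c - φ c‖)]
  · positivity

/-- The example amplitude as a real number. -/
noncomputable def realAmp (D : DistSeq) (L : Language Bool) {n : ℕ} (d : (Fin n → Bool) × Bool) :
    ℝ :=
  if d.2 = memBit L d.1 then Real.sqrt (D n d.1).toReal else 0

lemma exampleAmp_eq_realAmp (D : DistSeq) (L : Language Bool) {n : ℕ} (y : Fin n → Bool)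
    (b : Bool) : exampleAmp D L y b = (realAmp D L (y, b) : ℂ) := by
  unfold exampleAmp realAmp
  split_ifs <;> simp

lemma sum_toReal (D : DistSeq) (n : ℕ) : ∑ y, (D n y).toReal = 1 := by
  rw [← ENNReal.toReal_sum fun y _ => PMF.apply_ne_top _ _,
    ← tsum_fintype (L := .unconditional _), PMF.tsum_coe, ENNReal.toReal_one]

lemma sum_realAmp_mul (D : DistSeq) (L L' : Language Bool) (n : ℕ) :
    ∑ d : (Fin n → Bool) × Bool, realAmp D L d * realAmp D L' d =
      ∑ y : Fin n → Bool, if memBit L y = memBit L' y then (D n y).toReal else 0 := by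
  rw [Fintype.sum_prod_type]
  refine Finset.sum_congr rfl fun y _ => ?_
  simp only [realAmp, Fintype.sum_bool]
  cases memBit L y <;> cases memBit L' y <;> simp

/-- Sums over the contents of all qubits in which the input register holds `x` and the ancillas are
zero are sums over the contents of the advice registers. -/
lemma sum_wires {n : ℕ} (x : Fin n → Bool) (p a : ℕ) (F : (Fin p → (Fin n → Bool) × Bool) → ℝ) :
    (∑ c : Wire n p a → Bool,
      if (∀ i, c (.input i) = x i) ∧ (∀ i, c (.ancilla i) = false) then
        F fun k => (fun i => c (.data k i), c (.label k)) else 0) = ∑ d, F d := by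
  rw [← Finset.sum_filter]
  refine Finset.sum_nbij' (fun c k => (fun i => c (.data k i), c (.label k)))
    (fun d w => match w with
      | .input i => x i
      | .data k i => (d k).1 i
      | .label k => (d k).2
      | .ancilla _ => false) ?_ ?_ ?_ ?_ ?_
  · simp
  · simp
  · intro c hc
    obtain ⟨hx, ha⟩ := (Finset.mem_filter.1 hc).2
    funext w
    cases w <;> simp [hx, ha]
  · intro d _
    rfl
  · intro c _
    rfl

lemma initState_eq (D : DistSeq) (L : Language Bool) {n : ℕ} (x : Fin n → Bool) (p a : ℕ)
    (c : Wire n p a → Bool) :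
    initState D L x p a c =
      ((if (∀ i, c (.input i) = x i) ∧ (∀ i, c (.ancilla i) = false) then
        ∏ k, realAmp D L (fun i => c (.data k i), c (.label k)) else 0 : ℝ) : ℂ) := by
  unfold initState
  split_ifs <;> simp [exampleAmp_eq_realAmp]

lemma sum_prod_realAmp_mul (D : DistSeq) (L L' : Language Bool) (n p : ℕ) :
    ∑ d : Fin p → (Fin n → Bool) × Bool, (∏ k, realAmp D L (d k)) * ∏ k, realAmp D L' (d k) =
      (∑ y : Fin n → Bool, if memBit L y = memBit L' y then (D n y).toReal else 0) ^ p := by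
  rw [← sum_realAmp_mul, Fintype.sum_pow]
  simp only [Finset.prod_mul_distrib]

lemma sum_norm_sq_initState (D : DistSeq) (L : Language Bool) {n : ℕ} (x : Fin n → Bool) (p a : ℕ) :
    ∑ c, ‖initState D L x p a c‖ ^ 2 = 1 := by
  have h := sum_prod_realAmp_mul D L L n p
  simp only [if_true, sum_toReal, one_pow] at h
  rw [← h, ← sum_wires x p a]
  refine Finset.sum_congr rfl fun c _ => ?_
  rw [initState_eq, Complex.norm_real, Real.norm_eq_abs, sq_abs]
  split_ifs <;> simp [sq]

/-- The squared distance of the initial states of two languages is governed by the total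
probability of the strings on which the languages agree. -/
lemma sum_norm_sq_initState_sub (D : DistSeq) (L L' : Language Bool) {n : ℕ} (x : Fin n → Bool)
    (p a : ℕ) :
    ∑ c, ‖initState D L x p a c - initState D L' x p a c‖ ^ 2 =
      2 - 2 * (∑ y : Fin n → Bool,
        if memBit L y = memBit L' y then (D n y).toReal else 0) ^ p := by
  have h₁ := sum_prod_realAmp_mul D L L n p
  have h₂ := sum_prod_realAmp_mul D L' L' n p
  simp only [if_true, sum_toReal, one_pow] at h₁ h₂
  rw [← sum_prod_realAmp_mul]
  have e : ∑ c, ‖initState D L x p a c - initState D L' x p a c‖ ^ 2 =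
      ∑ d : Fin p → (Fin n → Bool) × Bool,
        (∏ k, realAmp D L (d k) - ∏ k, realAmp D L' (d k)) ^ 2 := by
    rw [← sum_wires x p a]
    refine Finset.sum_congr rfl fun c _ => ?_
    rw [initState_eq, initState_eq, ← Complex.ofReal_sub, Complex.norm_real]
    split_ifs <;> simp
  have e' : ∀ u v : ℝ, (u - v) ^ 2 = u * u + v * v - 2 * (u * v) := fun u v => by ring
  simp only [e, e', Finset.sum_sub_distrib, Finset.sum_add_distrib, ← Finset.mul_sum, h₁, h₂]
  norm_num

/-- Two languages which differ, on strings of length `n`, only in a string `x` of small probability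
cannot both be decided correctly on `x`. -/
lemma one_le_of_outputProb (D : DistSeq) (A : QAlgorithm) {n : ℕ} (x : Fin n → Bool)
    (L₀ L₁ : Language Bool) (h₀ : ∀ y : Fin n → Bool, memBit L₀ y = false)
    (h₁ : ∀ y : Fin n → Bool, memBit L₁ y = decide (y = x))
    (d₀ : 2 / 3 ≤ A.outputProb D L₀ x false) (d₁ : 2 / 3 ≤ A.outputProb D L₁ x true) :
    1 ≤ 36 * ((A.copies.eval n : ℕ) : ℝ) * (D n x).toReal := by
  unfold QAlgorithm.outputProb at d₀ d₁
  set gs := (A.circuit n).gates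
  set o := (A.circuit n).output
  set p := A.copies.eval n
  set ψ₀ := initState D L₀ x p (A.circuit n).ancillas with hψ₀
  set ψ₁ := initState D L₁ x p (A.circuit n).ancillas with hψ₁
  have hm := measureProb_le (runGates gs ψ₁) (runGates gs ψ₀) o true
  have ha := measureProb_add (runGates gs ψ₀) o
  rw [sum_norm_sq_runGates, hψ₀, sum_norm_sq_initState] at ha
  have hd : ∑ c, ‖runGates gs ψ₁ c - runGates gs ψ₀ c‖ ^ 2 = ∑ c, ‖ψ₁ c - ψ₀ c‖ ^ 2 := by
    have := sum_norm_sq_runGates gs (ψ₁ - ψ₀)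
    rw [runGates_sub] at this
    exact this
  have hs : (∑ y : Fin n → Bool, if memBit L₁ y = memBit L₀ y then (D n y).toReal else 0) =
      1 - (D n x).toReal := by
    have : ∀ y : Fin n → Bool, (if memBit L₁ y = memBit L₀ y then (D n y).toReal else 0) =
        (D n y).toReal - if y = x then (D n y).toReal else 0 := fun y => by
      rw [h₀, h₁]
      by_cases hy : y = x <;> simp [hy]
    simp [this, sum_toReal]
  rw [hd, hψ₁, hψ₀, sum_norm_sq_initState_sub, hs] at hm
  have hle : (D n x).toReal ≤ 1 := by
    simpa using ENNReal.toReal_mono ENNReal.one_ne_top (PMF.coe_le_one (D n) x)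
  -- Bernoulli: the squared distance `2 - 2 (1 - d) ^ p` of the initial states is at most `2 p d`,
  -- where `d` is the probability of `x`.
  have hb := one_add_mul_le_pow (a := -(D n x).toReal) (by linarith) p
  rw [← sub_eq_add_neg] at hb
  linarith

lemma exists_prob_le (D : DistSeq) (n : ℕ) :
    ∃ x : Fin n → Bool, (2 : ℝ) ^ n * (D n x).toReal ≤ 1 := by
  by_contra! h
  have := Finset.sum_lt_sum_of_nonempty (Finset.univ_nonempty (α := Fin n → Bool))
    fun x _ => h x
  rw [← Finset.mul_sum, sum_toReal] at this
  simp at this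

/-- On input lengths `n` at which the number of copies is small compared to `2 ^ n`, every algorithm
is wrong about the empty set or about a singleton. -/
lemma exists_sparse_failure (D : DistSeq) (A : QAlgorithm) (n : ℕ)
    (hn : 36 * A.copies.eval n < 2 ^ n) :
    ∃ s : Option (Fin n → Bool), ∀ L : Language Bool,
      (∀ y : Fin n → Bool, memBit L y = decide (s = some y)) → ¬ A.Decides D L := by
  obtain ⟨x, hx⟩ := exists_prob_le D n
  by_contra! h
  obtain ⟨L₀, h₀, d₀⟩ := h none
  obtain ⟨L₁, h₁, d₁⟩ := h (some x)
  have d₀' := d₀ n x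
  have d₁' := d₁ n x
  rw [h₀] at d₀'
  rw [h₁] at d₁'
  simp only [Option.some.injEq, eq_comm (a := x), decide_true, reduceCtorEq, decide_false]
    at h₀ h₁ d₀' d₁'
  have h1 := one_le_of_outputProb D A x L₀ L₁ h₀ h₁ d₀' d₁'
  have hn' : 36 * ((A.copies.eval n : ℕ) : ℝ) < 2 ^ n := by exact_mod_cast hn
  have hpos : 0 < (D n x).toReal := by
    refine lt_of_le_of_ne ENNReal.toReal_nonneg fun h0 => ?_
    rw [← h0] at h1
    norm_num at h1
  nlinarith [mul_lt_mul_of_pos_right hn' hpos]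

lemma eventually_eval_lt_two_pow (q : Polynomial ℕ) :
    ∀ᶠ n in Filter.atTop, 36 * q.eval n < 2 ^ n := by
  have h : (fun n : ℕ => ((q.eval n : ℕ) : ℝ)) =o[Filter.atTop] fun n : ℕ => (2 : ℝ) ^ n := by
    induction q using Polynomial.induction_on' with
    | add q r hq hr => simpa using hq.add hr
    | monomial k a =>
      simpa using (isLittleO_pow_const_const_pow_of_one_lt k
        (one_lt_two : (1 : ℝ) < 2)).const_mul_left (a : ℝ)
  filter_upwards [h.def (c := 1 / 37) (by norm_num)] with n hn
  rw [Real.norm_of_nonneg (by positivity), Real.norm_of_nonneg (by positivity)] at hn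
  have h2 : (0 : ℝ) < 2 ^ n := by positivity
  have : (36 : ℝ) * ((q.eval n : ℕ) : ℝ) < 2 ^ n := by linarith
  exact_mod_cast this

/-! ### Turing machines compute countably many functions -/

namespace TM2Code

open Turing.TM2 Turing.TM2.Stmt

section Transfer

variable {K K' Λ Λ' σ σ' G : Type} {Γ : K → Type}

/-- Rename the stacks, labels and states of a program along bijections, and its stack symbols along
maps `enc`, which are inverted by `dec` on the symbols that occur. -/
def transfer (eK : K ≃ K') (eΛ : Λ ≃ Λ') (eσ : σ ≃ σ') (enc : ∀ k, Γ k → G)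
    (dec : ∀ k, G → Option (Γ k)) : Stmt Γ Λ σ → Stmt (fun _ : K' => G) Λ' σ'
  | push k f q => push (eK k) (fun v => enc k (f (eσ.symm v))) (transfer eK eΛ eσ enc dec q)
  | peek k f q => peek (eK k) (fun v s => eσ (f (eσ.symm v) (s.bind (dec k))))
      (transfer eK eΛ eσ enc dec q)
  | pop k f q => pop (eK k) (fun v s => eσ (f (eσ.symm v) (s.bind (dec k))))
      (transfer eK eΛ eσ enc dec q)
  | load f q => load (fun v => eσ (f (eσ.symm v))) (transfer eK eΛ eσ enc dec q)
  | branch f q₁ q₂ => branch (fun v => f (eσ.symm v)) (transfer eK eΛ eσ enc dec q₁)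
      (transfer eK eΛ eσ enc dec q₂)
  | goto f => goto fun v => eΛ (f (eσ.symm v))
  | halt => halt

/-- The stack symbols which a statement may push. -/
def pushed : Stmt Γ Λ σ → Set (Σ k, Γ k)
  | push k f q => Set.range (fun v => ⟨k, f v⟩) ∪ pushed q
  | peek _ _ q => pushed q
  | pop _ _ q => pushed q
  | load _ q => pushed q
  | branch _ q₁ q₂ => pushed q₁ ∪ pushed q₂
  | goto _ => ∅
  | halt => ∅

lemma finite_pushed [Finite σ] (q : Stmt Γ Λ σ) : (pushed q).Finite := by
  induction q with
  | push k f q ih => exact (Set.finite_range _).union ih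
  | peek k f q ih => exact ih
  | pop k f q ih => exact ih
  | load f q ih => exact ih
  | branch f q₁ q₂ ih₁ ih₂ => exact ih₁.union ih₂
  | goto f => exact Set.finite_empty
  | halt => exact Set.finite_empty

/-- The stacks after renaming. -/
def transferStk (eK : K ≃ K') (enc : ∀ k, Γ k → G) (S : ∀ k, List (Γ k)) : K' → List G :=
  fun k' => (S (eK.symm k')).map (enc _)

/-- The configuration after renaming. -/
def transferCfg (eK : K ≃ K') (eΛ : Λ ≃ Λ') (eσ : σ ≃ σ') (enc : ∀ k, Γ k → G)
    (c : Cfg Γ Λ σ) : Cfg (fun _ : K' => G) Λ' σ' :=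
  ⟨c.l.map eΛ, eσ c.var, transferStk eK enc c.stk⟩

lemma transferStk_apply (eK : K ≃ K') (enc : ∀ k, Γ k → G) (S : ∀ k, List (Γ k)) (k : K) :
    transferStk eK enc S (eK k) = (S k).map (enc k) := by
  have h : ∀ k', k' = k → (S k').map (enc k') = (S k).map (enc k) := by
    rintro _ rfl
    rfl
  exact h _ (eK.symm_apply_apply k)

lemma transferStk_update [DecidableEq K] [DecidableEq K'] (eK : K ≃ K') (enc : ∀ k, Γ k → G)
    (S : ∀ k, List (Γ k)) (k : K) (w : List (Γ k)) :
    transferStk eK enc (Function.update S k w) =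
      Function.update (transferStk eK enc S) (eK k) (w.map (enc k)) := by
  funext k'
  obtain ⟨k', rfl⟩ := eK.surjective k'
  rw [transferStk_apply]
  by_cases h : k' = k
  · subst h
    simp
  · rw [Function.update_of_ne h, Function.update_of_ne (eK.injective.ne h), transferStk_apply]

/-- A renamed statement acts on renamed configurations as the original one does, as long as only
symbols from a set `A` occur on which `dec` inverts `enc`; no other symbols appear on the stacks. -/
lemma stepAux_transfer [DecidableEq K] [DecidableEq K'] (eK : K ≃ K') (eΛ : Λ ≃ Λ') (eσ : σ ≃ σ')
    (enc : ∀ k, Γ k → G) (dec : ∀ k, G → Option (Γ k)) (A : Set (Σ k, Γ k))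
    (hA : ∀ k a, ⟨k, a⟩ ∈ A → dec k (enc k a) = some a) (q : Stmt Γ Λ σ) (hq : pushed q ⊆ A)
    (v : σ) (S : ∀ k, List (Γ k)) (hS : ∀ k, ∀ a ∈ S k, ⟨k, a⟩ ∈ A) :
    stepAux (transfer eK eΛ eσ enc dec q) (eσ v) (transferStk eK enc S) =
        transferCfg eK eΛ eσ enc (stepAux q v S) ∧
      ∀ k, ∀ a ∈ (stepAux q v S).stk k, ⟨k, a⟩ ∈ A := by
  have hhead : ∀ (S : ∀ k, List (Γ k)), (∀ k, ∀ a ∈ S k, ⟨k, a⟩ ∈ A) → ∀ k,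
      (transferStk eK enc S (eK k)).head?.bind (dec k) = (S k).head? := fun S hS k => by
    rw [transferStk_apply]
    have := hS k
    cases h : S k with
    | nil => rfl
    | cons a w =>
      rw [h] at this
      simpa using hA k a (this a (by simp))
  induction q generalizing v S with
  | push k f q ih =>
    have hS' : ∀ k', ∀ a ∈ Function.update S k (f v :: S k) k', ⟨k', a⟩ ∈ A := by
      intro k' a ha
      by_cases h : k' = k
      · subst h
        rw [Function.update_self, List.mem_cons] at ha
        rcases ha with rfl | ha
        · exact hq (Or.inl ⟨v, rfl⟩)
        · exact hS _ _ ha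
      · rw [Function.update_of_ne h] at ha
        exact hS _ _ ha
    have := ih (fun x hx => hq (Or.inr hx)) v _ hS'
    rw [transferStk_update] at this
    simpa [transfer, transferStk_apply] using this
  | peek k f q ih =>
    have := ih hq (f v (S k).head?) S hS
    simpa [transfer, hhead S hS] using this
  | pop k f q ih =>
    have hS' : ∀ k', ∀ a ∈ Function.update S k (S k).tail k', ⟨k', a⟩ ∈ A := by
      intro k' a ha
      by_cases h : k' = k
      · subst h
        rw [Function.update_self] at ha
        exact hS _ _ (List.mem_of_mem_tail ha)
      · rw [Function.update_of_ne h] at ha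
        exact hS _ _ ha
    have := ih hq (f v (S k).head?) _ hS'
    rw [transferStk_update, List.map_tail, ← transferStk_apply eK enc S k] at this
    simpa [transfer, hhead S hS] using this
  | load f q ih => simpa [transfer] using ih hq (f v) S hS
  | branch f q₁ q₂ ih₁ ih₂ =>
    have h₁ := ih₁ (fun x hx => hq (Or.inl hx)) v S hS
    have h₂ := ih₂ (fun x hx => hq (Or.inr hx)) v S hS
    cases h : f v
    · simpa [transfer, h] using h₂
    · simpa [transfer, h] using h₁
  | goto f => exact ⟨by simp [transfer, transferCfg], by simpa using hS⟩
  | halt => exact ⟨by simp [transfer, transferCfg], by simpa using hS⟩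

end Transfer

section Runs

variable {K Λ σ : Type} {Γ : K → Type} [DecidableEq K]

/-- The configuration after `t` steps, if the machine does not halt before. -/
def iter (M : Λ → Stmt Γ Λ σ) (t : ℕ) (c : Cfg Γ Λ σ) : Option (Cfg Γ Λ σ) :=
  (flip bind (step M))^[t] (some c)

lemma iterate_none (M : Λ → Stmt Γ Λ σ) (t : ℕ) : (flip bind (step M))^[t] none = none := by
  induction t with
  | zero => rfl
  | succ t ih => rw [Function.iterate_succ_apply]; exact ih

lemma iter_succ (M : Λ → Stmt Γ Λ σ) (t : ℕ) (l : Λ) (v : σ) (S : ∀ k, List (Γ k)) :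
    iter M (t + 1) ⟨some l, v, S⟩ = iter M t (stepAux (M l) v S) := rfl

lemma iter_succ_halted (M : Λ → Stmt Γ Λ σ) (t : ℕ) (v : σ) (S : ∀ k, List (Γ k)) :
    iter M (t + 1) ⟨none, v, S⟩ = none := iterate_none M t

lemma iter_halted_unique (M : Λ → Stmt Γ Λ σ) (s t : ℕ) (c c₁ c₂ : Cfg Γ Λ σ)
    (h₁ : iter M s c = some c₁) (h₂ : iter M t c = some c₂) (hl₁ : c₁.l = none)
    (hl₂ : c₂.l = none) : c₁ = c₂ := by
  induction s generalizing t c with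
  | zero =>
    obtain rfl : c = c₁ := Option.some.inj h₁
    cases t with
    | zero => exact Option.some.inj h₂
    | succ t =>
      obtain ⟨l, v, S⟩ := c
      obtain rfl : l = none := hl₁
      simp [iter_succ_halted] at h₂
  | succ s ih =>
    obtain ⟨_ | l, v, S⟩ := c
    · simp [iter_succ_halted] at h₁
    · cases t with
      | zero =>
        obtain rfl := Option.some.inj h₂
        simp at hl₂
      | succ t => exact ih t _ h₁ h₂

/-- The machine with program `M`, input stack `k₀`, output stack `k₁`, initial label `l₀` and
initial state `v₀` computes the function `f` from numbers in unary to bit strings, where the maps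
`α` and `ω` translate bits into input and output symbols. -/
def Computes (M : Λ → Stmt Γ Λ σ) (k₀ k₁ : K) (l₀ : Λ) (v₀ : σ) (α : Bool → Γ k₀) (ω : Bool → Γ k₁)
    (f : ℕ → List Bool) : Prop :=
  Function.Injective ω ∧ ∀ n, ∃ t c, iter M t ⟨some l₀, v₀, Function.update (fun _ => []) k₀
    ((Computability.unaryEncodeNat n).map α)⟩ = some c ∧ c.l = none ∧ c.stk k₁ = (f n).map ω

lemma Computes.unique {M : Λ → Stmt Γ Λ σ} {k₀ k₁ : K} {l₀ : Λ} {v₀ : σ} {α : Bool → Γ k₀}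
    {ω : Bool → Γ k₁} {f g : ℕ → List Bool} (hf : Computes M k₀ k₁ l₀ v₀ α ω f)
    (hg : Computes M k₀ k₁ l₀ v₀ α ω g) : f = g := by
  funext n
  obtain ⟨s, c₁, h₁, hl₁, e₁⟩ := hf.2 n
  obtain ⟨t, c₂, h₂, hl₂, e₂⟩ := hg.2 n
  obtain rfl := iter_halted_unique M s t _ _ _ h₁ h₂ hl₁ hl₂
  exact List.map_injective_iff.2 hf.1 (e₁.symm.trans e₂)

end Runs

lemma iter_transfer {K K' Λ Λ' σ σ' G : Type} {Γ : K → Type} [DecidableEq K] [DecidableEq K']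
    (eK : K ≃ K') (eΛ : Λ ≃ Λ') (eσ : σ ≃ σ') (enc : ∀ k, Γ k → G) (dec : ∀ k, G → Option (Γ k))
    (A : Set (Σ k, Γ k)) (hA : ∀ k a, ⟨k, a⟩ ∈ A → dec k (enc k a) = some a) (M : Λ → Stmt Γ Λ σ)
    (hM : ∀ l, pushed (M l) ⊆ A) (t : ℕ) (c c' : Cfg Γ Λ σ)
    (hc : ∀ k, ∀ a ∈ c.stk k, ⟨k, a⟩ ∈ A) (h : iter M t c = some c') :
    iter (fun l => transfer eK eΛ eσ enc dec (M (eΛ.symm l))) t (transferCfg eK eΛ eσ enc c) =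
      some (transferCfg eK eΛ eσ enc c') := by
  induction t generalizing c with
  | zero => rw [Option.some.inj h]; rfl
  | succ t ih =>
    obtain ⟨_ | l, v, S⟩ := c
    · simp [iter_succ_halted] at h
    · have hs := stepAux_transfer eK eΛ eσ enc dec A hA (M l) (hM l) v S hc
      have := ih _ hs.2 h
      rw [← hs.1] at this
      rw [← this, transferCfg, Option.map_some, iter_succ, eΛ.symm_apply_apply]

lemma Computes.transfer {K K' Λ Λ' σ σ' G : Type} {Γ : K → Type} [DecidableEq K] [DecidableEq K']
    (eK : K ≃ K') (eΛ : Λ ≃ Λ') (eσ : σ ≃ σ') (enc : ∀ k, Γ k → G) (dec : ∀ k, G → Option (Γ k))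
    (A : Set (Σ k, Γ k)) (hA : ∀ k a, ⟨k, a⟩ ∈ A → dec k (enc k a) = some a) {M : Λ → Stmt Γ Λ σ}
    (hM : ∀ l, pushed (M l) ⊆ A) {k₀ k₁ : K} {l₀ : Λ} {v₀ : σ} {α : Bool → Γ k₀} {ω : Bool → Γ k₁}
    (hα : ∀ b, ⟨k₀, α b⟩ ∈ A) (hω : ∀ b, ⟨k₁, ω b⟩ ∈ A) {f : ℕ → List Bool}
    (h : Computes M k₀ k₁ l₀ v₀ α ω f) :
    Computes (fun l => TM2Code.transfer eK eΛ eσ enc dec (M (eΛ.symm l))) (eK k₀) (eK k₁) (eΛ l₀)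
      (eσ v₀) (fun b => enc k₀ (α b)) (fun b => enc k₁ (ω b)) f := by
  refine ⟨fun b b' hb => h.1 ?_, fun n => ?_⟩
  · have := congrArg (dec k₁) hb
    rw [hA _ _ (hω b), hA _ _ (hω b')] at this
    exact Option.some.inj this
  · obtain ⟨t, c, hc, hl, hk⟩ := h.2 n
    refine ⟨t, transferCfg eK eΛ eσ enc c, ?_, by simp [transferCfg, hl], ?_⟩
    · rw [← iter_transfer eK eΛ eσ enc dec A hA M hM t _ c ?_ hc, transferCfg,
        transferStk_update, List.map_map]
      · rfl
      · intro k a ha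
        by_cases hk : k = k₀
        · subst hk
          simp only [Function.update_self, List.mem_map] at ha
          obtain ⟨b, _, rfl⟩ := ha
          exact hα b
        · simp [Function.update_of_ne hk] at ha
    · simp [transferCfg, transferStk_apply, hk]

/-- Finitely many stack symbols can be encoded in a single finite alphabet. -/
lemma exists_enc_dec {K : Type} {Γ : K → Type} (A : Set (Σ k, Γ k)) (hA : A.Finite) :
    ∃ (g : ℕ) (enc : ∀ k, Γ k → Fin g) (dec : ∀ k, Fin g → Option (Γ k)),
      ∀ k a, ⟨k, a⟩ ∈ A → dec k (enc k a) = some a := by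
  classical
  have := hA.to_subtype
  obtain ⟨m, ⟨e⟩⟩ := Finite.exists_equiv_fin A
  let enc : ∀ k, Γ k → Fin (m + 1) := fun k a =>
    if h : ⟨k, a⟩ ∈ A then (e ⟨_, h⟩).castSucc else Fin.last m
  have hinj : ∀ k a a', ⟨k, a⟩ ∈ A → ⟨k, a'⟩ ∈ A → enc k a = enc k a' → a = a' := by
    intro k a a' ha ha' h
    simpa [enc, ha, ha'] using h
  refine ⟨m + 1, enc, fun k i => if h : ∃ a, ⟨k, a⟩ ∈ A ∧ enc k a = i then some h.choose else none,
    fun k a ha => ?_⟩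
  have h : ∃ a', ⟨k, a'⟩ ∈ A ∧ enc k a' = enc k a := ⟨a, ha, rfl⟩
  exact (dif_pos h).trans (congrArg some (hinj k _ _ h.choose_spec.1 ha h.choose_spec.2))

instance countable_stmt (k g l s : ℕ) :
    Countable (Stmt (fun _ : Fin k => Fin g) (Fin l) (Fin s)) := by
  obtain ⟨e₁, h₁⟩ := exists_injective_nat (Fin k × (Fin s → Fin g))
  obtain ⟨e₂, h₂⟩ := exists_injective_nat (Fin k × (Fin s → Option (Fin g) → Fin s))
  obtain ⟨e₃, h₃⟩ := exists_injective_nat (Fin s → Fin s)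
  obtain ⟨e₄, h₄⟩ := exists_injective_nat (Fin s → Bool)
  obtain ⟨e₅, h₅⟩ := exists_injective_nat (Fin s → Fin l)
  let enc : Stmt (fun _ : Fin k => Fin g) (Fin l) (Fin s) → ℕ := fun q =>
    Stmt.rec (fun k f _ r => Nat.pair 0 (Nat.pair (e₁ (k, f)) r))
      (fun k f _ r => Nat.pair 1 (Nat.pair (e₂ (k, f)) r))
      (fun k f _ r => Nat.pair 2 (Nat.pair (e₂ (k, f)) r))
      (fun f _ r => Nat.pair 3 (Nat.pair (e₃ f) r))
      (fun f _ _ r₁ r₂ => Nat.pair 4 (Nat.pair (e₄ f) (Nat.pair r₁ r₂)))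
      (fun f => Nat.pair 5 (e₅ f)) (Nat.pair 6 0) q
  refine Function.Injective.countable (f := enc) fun q => ?_
  induction q with
  | push k f q ih | peek k f q ih | pop k f q ih =>
    intro q' h
    cases q' <;> simp [enc, Nat.pair_eq_pair, h₁.eq_iff, h₂.eq_iff] at h
    obtain ⟨⟨rfl, rfl⟩, h⟩ := h
    rw [ih h]
  | load f q ih =>
    intro q' h
    cases q' <;> simp [enc, Nat.pair_eq_pair, h₃.eq_iff] at h
    obtain ⟨rfl, h⟩ := h
    rw [ih h]
  | branch f q₁ q₂ ih₁ ih₂ =>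
    intro q' h
    cases q' <;> simp [enc, Nat.pair_eq_pair, h₄.eq_iff] at h
    obtain ⟨rfl, h, h'⟩ := h
    rw [ih₁ h, ih₂ h']
  | goto f =>
    intro q' h
    cases q' <;> simp [enc, Nat.pair_eq_pair, h₅.eq_iff] at h
    rw [h]
  | halt =>
    intro q' h
    cases q' <;> simp [enc, Nat.pair_eq_pair] at h
    rfl

/-- Up to renaming, there are only countably many machines, and each computes at most one function
for each choice of input and output symbols. -/
lemma countable_computable :
    {f : ℕ → List Bool | Nonempty (Turing.TM2ComputableInPolyTime Computability.unaryEncodeNat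
      (id : List Bool → List Bool) f)}.Countable := by
  have hc : (⋃ (k : ℕ) (g : ℕ) (l : ℕ) (s : ℕ)
      (M : Fin l → Stmt (fun _ : Fin k => Fin g) (Fin l) (Fin s)) (k₀ : Fin k) (k₁ : Fin k)
      (l₀ : Fin l) (v₀ : Fin s) (α : Bool → Fin g) (ω : Bool → Fin g),
      {f | Computes M k₀ k₁ l₀ v₀ α ω f}).Countable := by
    iterate 11 refine Set.countable_iUnion fun _ => ?_
    refine Set.Subsingleton.countable ?_
    intro f hf g hg
    rw [Set.mem_ofPred_eq] at hf hg
    exact hf.unique hg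
  refine hc.mono ?_
  rintro f ⟨⟨⟨tm, inp, out⟩, time, h⟩⟩
  have := tm.kFin
  have := tm.ΛFin
  have := tm.σFin
  have := tm.Γk₀Fin
  have : Finite (tm.Γ tm.k₁) := Finite.of_equiv _ out.symm
  -- The alphabets of the other stacks may be infinite, but a machine pushes only finitely many
  -- symbols.
  let A : Set (Σ k, tm.Γ k) :=
    (⋃ l, pushed (tm.m l)) ∪ (Set.range (Sigma.mk tm.k₀) ∪ Set.range (Sigma.mk tm.k₁))
  have hA : A.Finite := (Set.finite_iUnion fun l => finite_pushed _).union
    ((Set.finite_range _).union (Set.finite_range _))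
  obtain ⟨g, enc, dec, hdec⟩ := exists_enc_dec A hA
  have hf : Computes tm.m tm.k₀ tm.k₁ tm.main tm.initialState inp.symm out.symm f := by
    refine ⟨out.symm.injective, fun n =>
      ⟨(h n).steps, Turing.haltList tm ((f n).map out.symm), ?_, rfl, by simp [Turing.haltList]⟩⟩
    have hinit : Turing.initList tm ((Computability.unaryEncodeNat n).map inp.symm) =
        ⟨some tm.main, tm.initialState, Function.update (fun _ => []) tm.k₀
          ((Computability.unaryEncodeNat n).map inp.symm)⟩ := by
      unfold Turing.initList
      congr 1
      funext k
      by_cases hk : k = tm.k₀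
      · subst hk
        simp
      · simp [hk]
    have hrun := (h n).evals_in_steps
    exact (congrArg (fun c => (flip bind (step tm.m))^[(h n).steps] (some c)) hinit.symm).trans hrun
  have := hf.transfer (Fintype.equivFin _) (Fintype.equivFin _) (Fintype.equivFin _) enc dec A hdec
    (fun l => (Set.subset_iUnion (fun l => pushed (tm.m l)) l).trans Set.subset_union_left)
    (fun b => Or.inr (Or.inl ⟨_, rfl⟩)) (fun b => Or.inr (Or.inr ⟨_, rfl⟩))
  simp only [Set.mem_iUnion]
  exact ⟨_, _, _, _, _, _, _, _, _, _, _, this⟩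

end TM2Code

/-! ### Algorithms are determined by their descriptions -/

/-- The names of qubits form a prefix code. -/
lemma Wire.code_append_inj {n p a : ℕ} (w w' : Wire n p a) (l l' : List ℕ) :
    w.code ++ l = w'.code ++ l' ↔ w = w' ∧ l = l' := by
  cases w <;> cases w' <;> simp [Wire.code, Fin.ext_iff, and_assoc]

/-- The names of gates form a prefix code. -/
lemma Gate.code_append_inj {n p a : ℕ} (g g' : Gate (Wire n p a)) (l l' : List ℕ) :
    g.code ++ l = g'.code ++ l' ↔ g = g' ∧ l = l' := by
  cases g <;> cases g' <;>
    simp [Gate.code, Wire.code_append_inj, and_assoc]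

lemma flatMap_gateCode_injective {n p a : ℕ} :
    Function.Injective fun gs : List (Gate (Wire n p a)) => gs.flatMap Gate.code := by
  have hne : ∀ g : Gate (Wire n p a), g.code ≠ [] := fun g => by cases g <;> simp [Gate.code]
  intro gs
  induction gs with
  | nil =>
    intro gs' h
    cases gs' with
    | nil => rfl
    | cons g gs' => exact absurd (by simpa using h) (by simp [hne])
  | cons g gs ih =>
    intro gs' h
    cases gs' with
    | nil => exact absurd (by simpa using h) (by simp [hne])
    | cons g' gs' =>
      simp only [List.flatMap_cons] at h
      obtain ⟨rfl, h'⟩ := (Gate.code_append_inj _ _ _ _).1 h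
      rw [ih h']

lemma describe_injective {n p : ℕ} :
    Function.Injective (AdviceCircuit.describe : AdviceCircuit n p → List Bool) := by
  rintro ⟨a, gs, o⟩ ⟨a', gs', o'⟩ h
  obtain ⟨rfl, h₁⟩ := List.cons.inj (bitsOfList_injective h)
  obtain ⟨rfl, h₂⟩ := (Wire.code_append_inj _ _ _ _).1 h₁
  obtain rfl := flatMap_gateCode_injective h₂
  rfl

instance countable_qAlgorithm : Countable QAlgorithm := by
  have : Countable {f : ℕ → List Bool | Nonempty (Turing.TM2ComputableInPolyTime
      Computability.unaryEncodeNat (id : List Bool → List Bool) f)} :=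
    TM2Code.countable_computable.to_subtype
  have : Countable (Polynomial ℕ) := 
    (AddMonoidAlgebra.coeff_injective.comp Polynomial.toFinsupp_injective).countable
  refine Function.Injective.countable (β := Polynomial ℕ × {f : ℕ → List Bool | Nonempty
    (Turing.TM2ComputableInPolyTime Computability.unaryEncodeNat (id : List Bool → List Bool) f)})
    (f := fun A => (A.copies, ⟨fun n => (A.circuit n).describe, A.uniform⟩)) ?_
  rintro ⟨q, C, hC⟩ ⟨q', C', hC'⟩ h
  simp only [Prod.mk.injEq, Subtype.mk.injEq] at h
  obtain ⟨rfl, h'⟩ := h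
  obtain rfl : C = C' := funext fun n => describe_injective (congrFun h' n)
  rfl

/-! ### Diagonalization -/

theorem theorem3 (D : DistSeq) : BQPqsampFixed D ⊂ BQPqsamp := by
  refine ⟨fun L ⟨A, hA⟩ => ⟨A, D, hA⟩, fun hsub => ?_⟩
  have : Nonempty QAlgorithm := ⟨EqualityTest.algorithm⟩
  obtain ⟨A, hA⟩ := exists_surjective_nat QAlgorithm
  -- The length `φ i` is reserved for the `i`-th algorithm, and long enough for it to fail there.
  obtain ⟨φ, hφ, hlt⟩ := Filter.extraction_forall_of_eventually'
    fun i => (Filter.eventually_atTop.1 (eventually_eval_lt_two_pow (A i).copies))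
  have hex : ∀ n, ∃ s : Option (Fin n → Bool), ∀ i, φ i = n → ∀ L : Language Bool,
      (∀ y : Fin n → Bool, memBit L y = decide (s = some y)) → ¬ (A i).Decides D L := by
    intro n
    by_cases h : ∃ i, φ i = n
    · obtain ⟨i, rfl⟩ := h
      obtain ⟨s, hs⟩ := exists_sparse_failure D (A i) (φ i) (hlt i)
      refine ⟨s, fun j hj => ?_⟩
      obtain rfl := hφ.injective hj
      exact hs
    · exact ⟨none, fun i hi => absurd ⟨i, hi⟩ h⟩
  choose o ho using hex
  obtain ⟨B, hB⟩ := hsub (sparseLanguage_mem_BQPqsamp o)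
  obtain ⟨i, rfl⟩ := hA B
  exact ho (φ i) i rfl _ (fun y => memBit_sparseLanguage o y) hB
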